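/- **Theorem.** Formulas of the logic $\mathsf{LHS}$ are given by $$\varphi ::= p^l_i \mid p^r_i \mid I \mid \neg\varphi \mid \varphi\wedge\varphi \mid \Box\varphi \mid \blacksquare\varphi \qquad (i\in\mathbb N),$$ where $\{p^l_i\}_{i\in\mathbb N}$ and $\{p^r_i\}_{i\in\mathbb N}$ are two disjoint countable sets of propositional variables. A model $M=(W,R,V)$ consists of a non-empty set $W$, a single binary relation $R\subseteq W\times W$, and a valuation $V$ assigning a subset of $W$ to every propositional variable. Truth at a pair of states $s,t\in W$ is defined by: $M,s,t\models p^l_i$ iff $s\in V(p^l_i)$; $M,s,t\models p^r_i$ iff $t\in V(p^r_i)$; $M,s,t\models I$ iff $s=t$; the usual clauses for $\neg,\wedge$; $M,s,t\models\Box\varphi$ iff $M,s',t\models\varphi$ for all $s'$ with $sRs'$; $M,s,t\models\blacksquare\varphi$ iff $M,s,t'\models\varphi$ for all $t'$ with $tRt'$. A formula $\varphi$ is satisfiable if $M,s,t\models\varphi$ for some model $M$ and some states $s,t$ of $M$. Then the satisfiability problem for $\mathsf{LHS}$ is undecidable: there is no algorithm that decides, given a formula $\varphi$, whether $\varphi$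 is satisfiable. Moreover, the $\mathbb N\times\mathbb N$ tiling problem reduces to it: there is a computable map $\mathbb T\mapsto\varphi_{\mathbb T}$ from finite sets of tile types (a tile type being given by the colors $\mathrm{up},\mathrm{down},\mathrm{left},\mathrm{right}\in\mathbb N$ of its four edges) to formulas such that $\varphi_{\mathbb T}$ is satisfiable if and only if $\mathbb T$ tiles $\mathbb N\times\mathbb N$, i.e. there is $g:\mathbb N\times\mathbb N\to\mathbb T$ with $\mathrm{right}(g(n,m))=\mathrm{left}(g(n+1,m))$ and $\mathrm{up}(g(n,m))=\mathrm{down}(g(n,m+1))$ for all $n,m\in\mathbb N$. -/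

import Mathlib

universe u

namespace LHS

/-- Formulas of the logic of hide and seek. The two disjoint countable families of propositional
variables are `pl i` and `pr i`, for `i : ℕ`; `box` is the white box (first evaluation state) and
`bbox` the black box (second evaluation state). -/
inductive Formula : Type
  | eqc : Formula
  | pl : ℕ → Formula
  | pr : ℕ → Formula
  | neg : Formula → Formula
  | and : Formula → Formula → Formula
  | box : Formula → Formula
  | bbox : Formula → Formula

/-- A model: a non-empty set of states, a single binary relation, and a valuation of both kinds of
propositional variables (`Sum.inl i` is the `i`-th left variable, `Sum.inr i` the `i`-th right
one). -/
structure Model where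
  W : Type u
  nonempty : Nonempty W
  R : W → W → Prop
  V : ℕ ⊕ ℕ → Set W

/-- Truth of a formula at a pair of states of a model. -/
def Holds (M : Model) : M.W → M.W → Formula → Prop
  | s, t, .eqc => s = t
  | s, _, .pl i => s ∈ M.V (Sum.inl i)
  | _, t, .pr i => t ∈ M.V (Sum.inr i)
  | s, t, .neg φ => ¬ Holds M s t φ
  | s, t, .and φ ψ => Holds M s t φ ∧ Holds M s t ψ
  | s, t, .box φ => ∀ s', M.R s s' → Holds M s' t φ
  | s, t, .bbox φ => ∀ t', M.R t t' → Holds M s t' φ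

/-- A formula is satisfiable if it is true at some pair of states of some model. -/
def Satisfiable (φ : Formula) : Prop :=
  ∃ (M : Model.{u}) (s t : M.W), Holds M s t φ

/-! ### Gödel numbering of formulas -/

/-- The Gödel number of a formula. -/
def Formula.toNat : Formula → ℕ
  | .eqc => 0
  | .pl i => 6 * i + 1
  | .pr i => 6 * i + 2
  | .neg φ => 6 * φ.toNat + 3
  | .and φ ψ => 6 * Nat.pair φ.toNat ψ.toNat + 4
  | .box φ => 6 * φ.toNat + 5
  | .bbox φ => 6 * φ.toNat + 6

/-- The formula with a given Gödel number. -/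
def Formula.ofNat : ℕ → Formula
  | 0 => .eqc
  | n + 1 =>
    have h : n / 6 ≤ n := Nat.div_le_self n 6
    have _h₁ : (n / 6).unpair.1 ≤ n := (Nat.unpair_left_le _).trans h
    have _h₂ : (n / 6).unpair.2 ≤ n := (Nat.unpair_right_le _).trans h
    match n % 6 with
    | 0 => .pl (n / 6)
    | 1 => .pr (n / 6)
    | 2 => .neg (Formula.ofNat (n / 6))
    | 3 => .and (Formula.ofNat (n / 6).unpair.1) (Formula.ofNat (n / 6).unpair.2)
    | 4 => .box (Formula.ofNat (n / 6))
    | _ => .bbox (Formula.ofNat (n / 6))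

theorem Formula.ofNat_toNat (φ : Formula) : Formula.ofNat φ.toNat = φ := by
  have hd : ∀ m k : ℕ, k < 6 → (6 * m + k) / 6 = m ∧ (6 * m + k) % 6 = k := by omega
  induction φ with
  | eqc => simp [Formula.toNat, Formula.ofNat]
  | pl i => simp [Formula.toNat, Formula.ofNat]
  | pr i =>
    have h := hd i 1 (by omega)
    simp [Formula.toNat, Formula.ofNat, h]
  | neg φ ih =>
    have h := hd φ.toNat 2 (by omega)
    simp [Formula.toNat, Formula.ofNat, h, ih]
  | and φ ψ ih₁ ih₂ =>
    have h := hd (Nat.pair φ.toNat ψ.toNat) 3 (by omega)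
    simp [Formula.toNat, Formula.ofNat, h, ih₁, ih₂]
  | box φ ih =>
    have h := hd φ.toNat 4 (by omega)
    simp [Formula.toNat, Formula.ofNat, h, ih]
  | bbox φ ih =>
    have h := hd φ.toNat 5 (by omega)
    simp [Formula.toNat, Formula.ofNat, h, ih]

theorem Formula.toNat_ofNat (n : ℕ) : (Formula.ofNat n).toNat = n := by
  induction n using Nat.strong_induction_on with
  | _ n ih =>
    cases n with
    | zero => simp [Formula.toNat, Formula.ofNat]
    | succ n =>
      have h : n / 6 ≤ n := Nat.div_le_self n 6
      have i₀ := ih (n / 6) (by omega)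
      have i₁ := ih (n / 6).unpair.1 (by have := Nat.unpair_left_le (n / 6); omega)
      have i₂ := ih (n / 6).unpair.2 (by have := Nat.unpair_right_le (n / 6); omega)
      have hm : n % 6 = 0 ∨ n % 6 = 1 ∨ n % 6 = 2 ∨ n % 6 = 3 ∨ n % 6 = 4 ∨ n % 6 = 5 := by omega
      rw [Formula.ofNat]
      rcases hm with hm | hm | hm | hm | hm | hm <;>
        simp only [hm, Formula.toNat, i₀, i₁, i₂, Nat.pair_unpair] <;> omega

/-- The Gödel numbering is a bijection between formulas and natural numbers. -/
def Formula.equivNat : Formula ≃ ℕ where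
  toFun := Formula.toNat
  invFun := Formula.ofNat
  left_inv := Formula.ofNat_toNat
  right_inv := Formula.toNat_ofNat

/-- Computability on formulas is computability on their Gödel numbers. -/
instance : Primcodable Formula := Primcodable.ofEquiv ℕ Formula.equivNat

/-! ### The tiling problem -/

/-- A tile type, given by the colors of its up, down, left and right edges. -/
abbrev Tile : Type := ℕ × ℕ × ℕ × ℕ

def Tile.up (T : Tile) : ℕ := T.1

def Tile.down (T : Tile) : ℕ := T.2.1

def Tile.left (T : Tile) : ℕ := T.2.2.1

def Tile.right (T : Tile) : ℕ := T.2.2.2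

/-- A finite list of tile types tiles `ℕ × ℕ` if the quadrant can be covered by copies of these
tiles such that adjacent edges have the same color. -/
def TilesQuadrant (𝕋 : List Tile) : Prop :=
  ∃ g : ℕ × ℕ → Tile, (∀ x, g x ∈ 𝕋) ∧
    ∀ n m : ℕ, Tile.right (g (n, m)) = Tile.left (g (n + 1, m)) ∧
      Tile.up (g (n, m)) = Tile.down (g (n, m + 1))

end LHS

namespace LHS

namespace Formula

/-! ### Derived connectives -/

/-! A single relation is made to code countably many: a root sees the elements of a structure, an
element sees edges, an edge carries a label `2 * k` and sees its target. Then `boxL k` and `boxR k`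
move the left and right state along the `k`-th relation. Left and right labels are independent
variables, so the two versions of a relation may differ; `link k`, imposed on the diagonal, makes
them agree. Since `eqc` compares two independent walks started at the same element, path equations
become expressible, such as commutation or functionality. `exists_interp_of_satisfiable` reads a
structure off a model of `system α β`, and `satisfiable_system` codes a given structure into a
model.

For tilings, `system (tilingAxiom l) top` asserts serial commuting relations `0` and `1` with
matching tiles. Choosing successor functions `H`, `V` and iterating them from any element gives a
tiling, and a tiling makes `ℕ × ℕ` a model.

Undecidability is proved independently of tilings, from the halting problem. The axioms describe
lists of numbers and the evaluation equations of the subcodes of a fixed universal code. In any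
model the coded relations contain the true computations (`exists_of_mem_eval`), possibly along with
spurious ones. Hence an input marked as undefined really diverges; conversely, divergence makes the
structure of actual lists a model. So divergence reduces to satisfiability. -/

def imp (φ ψ : Formula) : Formula := .neg (.and φ (.neg ψ))

def top : Formula := imp .eqc .eqc

def bigAnd (l : List Formula) : Formula := l.foldr .and top

def bigOr (l : List Formula) : Formula := .neg (bigAnd (l.map .neg))

/-- The left box along the `k`-th coded relation: `x` is related to `y` if some successor of `x`
with the label `2 * k` has `y` as a successor. -/
def boxL (k : ℕ) (φ : Formula) : Formula := .box (imp (.pl (2 * k)) (.box φ))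

/-- The right box along the `k`-th coded relation. -/
def boxR (k : ℕ) (φ : Formula) : Formula := .bbox (imp (.pr (2 * k)) (.bbox φ))

def diaL (k : ℕ) (φ : Formula) : Formula := .neg (boxL k (.neg φ))

def diaR (k : ℕ) (φ : Formula) : Formula := .neg (boxR k (.neg φ))

/-- The `k`-th proposition about the left state. -/
def prop (k : ℕ) : Formula := .pl (2 * k + 1)

/-- At a diagonal pair: the left and right versions of the `k`-th coded relation agree. -/
def link (k : ℕ) : Formula := .and (boxL k (diaR k .eqc)) (boxR k (diaL k .eqc))

/-- At a diagonal pair: the successors of the root are closed under three-step paths starting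
at the root. -/
def closed : Formula := .box (.box (.box (.neg (.bbox (.neg .eqc)))))

/-- `φ` holds at all diagonal pairs of successors of the root. -/
def everywhere (φ : Formula) : Formula := .box (.bbox (imp .eqc φ))

/-- The root sees a coded multi-relational structure in which `α` holds everywhere and `β`
somewhere on the diagonal. -/
def system (α β : Formula) : Formula :=
  .and .eqc (.and closed (.and (everywhere α) (.neg (everywhere (.neg β)))))

end Formula

open Formula

/-! ### Semantics of the derived connectives and coded structures -/

section Holds

variable {M : Model.{u}} {s t : M.W} {φ ψ : Formula}

theorem holds_neg : Holds M s t (.neg φ) ↔ ¬ Holds M s t φ := by simp [Holds]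

theorem holds_and : Holds M s t (.and φ ψ) ↔ Holds M s t φ ∧ Holds M s t ψ := by simp [Holds]

theorem holds_imp : Holds M s t (imp φ ψ) ↔ (Holds M s t φ → Holds M s t ψ) := by
  simp [imp, Holds]

theorem holds_top : Holds M s t top ↔ True := by simp [top, holds_imp]

theorem holds_bigAnd {l : List Formula} :
    Holds M s t (bigAnd l) ↔ ∀ φ ∈ l, Holds M s t φ := by
  induction l with
  | nil => simp [bigAnd, holds_top]
  | cons a l ih =>
    simp only [bigAnd, List.foldr_cons, holds_and, List.forall_mem_cons] at ih ⊢
    rw [ih]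

theorem holds_bigOr {l : List Formula} :
    Holds M s t (bigOr l) ↔ ∃ φ ∈ l, Holds M s t φ := by
  simp [bigOr, holds_neg, holds_bigAnd]

theorem holds_everywhere {r : M.W} :
    Holds M r r (everywhere φ) ↔ ∀ x, M.R r x → Holds M x x φ := by
  simp only [everywhere, Holds, holds_imp]
  exact ⟨fun h x hx => h x hx x hx rfl, fun h x hx y hy e => by subst e; exact h x hx⟩

end Holds

/-- A multi-relational structure coded in a model. -/
structure Interp (M : Model.{u}) (D : Type*) where
  ι : D → M.W
  inj : Function.Injective ι
  relL : ℕ → D → D → Prop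
  relR : ℕ → D → D → Prop
  holds_boxL : ∀ k φ x t, Holds M (ι x) t (boxL k φ) ↔ ∀ y, relL k x y → Holds M (ι y) t φ
  holds_boxR : ∀ k φ s x, Holds M s (ι x) (boxR k φ) ↔ ∀ y, relR k x y → Holds M s (ι y) φ

namespace Interp

variable {M : Model.{u}} {D : Type*} (I : Interp M D) {φ : Formula} {k : ℕ} {x y : D} {s t : M.W}

theorem holds_eqc : Holds M (I.ι x) (I.ι y) .eqc ↔ x = y := by simp [Holds, I.inj.eq_iff]

theorem holds_diaL :
    Holds M (I.ι x) t (diaL k φ) ↔ ∃ y, I.relL k x y ∧ Holds M (I.ι y) t φ := by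
  simp [diaL, holds_neg, I.holds_boxL]

theorem holds_diaR :
    Holds M s (I.ι x) (diaR k φ) ↔ ∃ y, I.relR k x y ∧ Holds M s (I.ι y) φ := by
  simp [diaR, holds_neg, I.holds_boxR]

theorem holds_link :
    Holds M (I.ι x) (I.ι x) (link k) ↔
      (∀ y, I.relL k x y → I.relR k x y) ∧ ∀ y, I.relR k x y → I.relL k x y := by
  simp [link, holds_and, I.holds_boxL, I.holds_boxR, I.holds_diaL, I.holds_diaR, I.holds_eqc]

end Interp

/-- The domain consists of the successors of the root. The condition `closed` keeps targets of edges
inside it, so that quantifying over the domain captures the full meaning of the boxes. -/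
theorem exists_interp_of_satisfiable {α β : Formula} (h : Satisfiable.{u} (system α β)) :
    ∃ (M : Model.{u}) (D : Type u) (I : Interp M D),
      (∀ x, Holds M (I.ι x) (I.ι x) α) ∧ ∃ x, Holds M (I.ι x) (I.ι x) β := by
  obtain ⟨M, r, t, h⟩ := h
  obtain ⟨rfl : r = t, hc, hα, hβ⟩ := h
  -- While the left state makes three steps, the right state waits at `r`; one right step then has
  -- to reach the left state.
  have hc' : ∀ x, M.R r x → ∀ e, M.R x e → ∀ y, M.R e y → M.R r y := by
    simpa [closed, Holds] using hc
  simp only [holds_everywhere] at hα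
  have hβ' : ∃ x, M.R r x ∧ Holds M x x β := by
    simpa [holds_everywhere, holds_neg, Holds] using hβ
  let I : Interp M {x // M.R r x} :=
    { ι := Subtype.val
      inj := Subtype.val_injective
      relL := fun k x y => ∃ e, M.R x e ∧ e ∈ M.V (Sum.inl (2 * k)) ∧ M.R e y
      relR := fun k x y => ∃ e, M.R x e ∧ e ∈ M.V (Sum.inr (2 * k)) ∧ M.R e y
      holds_boxL := by
        intro k φ x t
        simp only [boxL, Holds, holds_imp]
        constructor
        · rintro h y ⟨e, he, hk, hy⟩
          exact h e he hk y hy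
        · intro h e he hk y hy
          exact h ⟨y, hc' x x.2 e he y hy⟩ ⟨e, he, hk, hy⟩
      holds_boxR := by
        intro k φ s x
        simp only [boxR, Holds, holds_imp]
        constructor
        · rintro h y ⟨e, he, hk, hy⟩
          exact h e he hk y hy
        · intro h e he hk y hy
          exact h ⟨y, hc' x x.2 e he y hy⟩ ⟨e, he, hk, hy⟩ }
  obtain ⟨x, hx, hβ⟩ := hβ'
  exact ⟨M, _, I, fun x => hα x x.2, ⟨x, hx⟩, hβ⟩

/-! ### The model coding a given structure -/

section Coding

variable {D : Type} (rel : ℕ → D → D → Prop) (P : ℕ → D → Prop)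

/-- The accessibility relation of the coding model: the root sees the elements of the structure,
and an element sees the edges leaving it, which see their targets. -/
def codingRel : Option (D ⊕ ℕ × D) → Option (D ⊕ ℕ × D) → Prop
  | none, some (.inl _) => True
  | some (.inl x), some (.inr (k, y)) => rel k x y
  | some (.inr (_, y)), some (.inl z) => y = z
  | _, _ => False

/-- The labels in the coding model: even ones for edges, odd ones for elements. -/
def codingVal (j : ℕ) : Option (D ⊕ ℕ × D) → Prop
  | none => False
  | some (.inl x) => ∃ i, j = 2 * i + 1 ∧ P i x
  | some (.inr (k, _)) => j = 2 * k

/-- Left and right variables receive the same valuation, so both versions of each coded relation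
coincide with `rel`. The `ULift` reaches an arbitrary universe. -/
def codingModel : Model.{u} where
  W := ULift (Option (D ⊕ ℕ × D))
  nonempty := ⟨⟨none⟩⟩
  R a b := codingRel rel a.down b.down
  V j := {a | codingVal P (j.elim id id) a.down}

/-- The structure coded in its coding model. -/
def codingInterp : Interp (codingModel.{u} rel P) D where
  ι x := ⟨some (.inl x)⟩
  inj _ _ h := Sum.inl_injective (Option.some_injective _ (congrArg ULift.down h))
  relL := rel
  relR := rel
  holds_boxL k φ x t := by
    simp only [boxL, Holds, holds_imp]
    constructor
    · intro h y hy
      exact h ⟨some (.inr (k, y))⟩ hy rfl ⟨some (.inl y)⟩ rfl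
    -- Only an edge followed by an element is a possible path from an element; the label of the edge
    -- then identifies the relation.
    · rintro h ⟨_ | x' | ⟨j, y⟩⟩ he hk ⟨_ | z | z⟩ hz
      all_goals try exact False.elim he
      all_goals try exact False.elim hz
      obtain rfl : y = z := hz
      have : 2 * k = 2 * j := hk
      obtain rfl : k = j := by omega
      exact h y he
  holds_boxR k φ s x := by
    simp only [boxR, Holds, holds_imp]
    constructor
    · intro h y hy
      exact h ⟨some (.inr (k, y))⟩ hy rfl ⟨some (.inl y)⟩ rfl
    · rintro h ⟨_ | x' | ⟨j, y⟩⟩ he hk ⟨_ | z | z⟩ hz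
      all_goals try exact False.elim he
      all_goals try exact False.elim hz
      obtain rfl : y = z := hz
      have : 2 * k = 2 * j := hk
      obtain rfl : k = j := by omega
      exact h y he

theorem codingInterp_relL : (codingInterp.{u} rel P).relL = rel := rfl

theorem codingInterp_relR : (codingInterp.{u} rel P).relR = rel := rfl

theorem holds_prop_coding {x : D} {t} {k : ℕ} :
    Holds (codingModel.{u} rel P) ((codingInterp rel P).ι x) t (prop k) ↔ P k x := by
  change (∃ i, 2 * k + 1 = 2 * i + 1 ∧ P i x) ↔ P k x
  constructor
  · rintro ⟨i, hi, h⟩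
    obtain rfl : k = i := by omega
    exact h
  · exact fun h => ⟨k, rfl, h⟩

theorem satisfiable_system {α β : Formula}
    (hα : ∀ x, Holds (codingModel.{u} rel P) ((codingInterp rel P).ι x)
      ((codingInterp rel P).ι x) α)
    (hβ : ∃ x, Holds (codingModel.{u} rel P) ((codingInterp rel P).ι x)
      ((codingInterp rel P).ι x) β) :
    Satisfiable.{u} (system α β) := by
  refine ⟨codingModel rel P, ⟨none⟩, ⟨none⟩, rfl, ?_, ?_, ?_⟩
  · rintro ⟨_ | x | x⟩ hx ⟨_ | e | e⟩ he ⟨_ | y | y⟩ hy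
    all_goals try exact False.elim hx
    all_goals try exact False.elim he
    all_goals try exact False.elim hy
    exact fun h => h ⟨some (.inl y)⟩ trivial rfl
  · refine holds_everywhere.2 ?_
    rintro ⟨_ | x | x⟩ hx
    all_goals try exact False.elim hx
    exact hα x
  · obtain ⟨x, hx⟩ := hβ
    exact fun h => holds_everywhere.1 h ⟨some (.inl x)⟩ trivial hx

end Coding

/-! ### Computability of the connectives -/

section Computability

open Primrec

variable {A : Type*} [Primcodable A]

/-- The coding of formulas is transported along `Formula.equivNat`, so each connective reduces to
arithmetic on Gödel numbers. -/
theorem primrec_iff_toNat {f : A → Formula} : Primrec f ↔ Primrec fun a => (f a).toNat :=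
  (Primrec.of_equiv_iff Formula.equivNat).symm

theorem primrec_toNat : Primrec Formula.toNat := Primrec.of_equiv (e := Formula.equivNat)

theorem primrec_affine (m k : ℕ) {f : A → ℕ} (hf : Primrec f) : Primrec fun a => m * f a + k :=
  nat_add.comp (nat_mul.comp (Primrec.const m) hf) (Primrec.const k)

theorem primrec_pl {f : A → ℕ} (hf : Primrec f) : Primrec fun a => Formula.pl (f a) :=
  primrec_iff_toNat.2 (primrec_affine 6 1 hf)

theorem primrec_neg {f : A → Formula} (hf : Primrec f) : Primrec fun a => Formula.neg (f a) :=
  primrec_iff_toNat.2 (primrec_affine 6 3 (primrec_toNat.comp hf))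

theorem primrec_and {f g : A → Formula} (hf : Primrec f) (hg : Primrec g) :
    Primrec fun a => Formula.and (f a) (g a) :=
  primrec_iff_toNat.2 (primrec_affine 6 4
    (Primrec₂.natPair.comp (primrec_toNat.comp hf) (primrec_toNat.comp hg)))

theorem primrec_box {f : A → Formula} (hf : Primrec f) : Primrec fun a => Formula.box (f a) :=
  primrec_iff_toNat.2 (primrec_affine 6 5 (primrec_toNat.comp hf))

theorem primrec_bbox {f : A → Formula} (hf : Primrec f) : Primrec fun a => Formula.bbox (f a) :=
  primrec_iff_toNat.2 (primrec_affine 6 6 (primrec_toNat.comp hf))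

theorem primrec_imp {f g : A → Formula} (hf : Primrec f) (hg : Primrec g) :
    Primrec fun a => imp (f a) (g a) :=
  primrec_neg (primrec_and hf (primrec_neg hg))

theorem primrec_diaL (k : ℕ) {f : A → Formula} (hf : Primrec f) :
    Primrec fun a => diaL k (f a) :=
  primrec_neg (primrec_box (primrec_imp (Primrec.const _) (primrec_box (primrec_neg hf))))

theorem primrec_everywhere {f : A → Formula} (hf : Primrec f) :
    Primrec fun a => everywhere (f a) :=
  primrec_box (primrec_bbox (primrec_imp (Primrec.const _) hf))

theorem primrec_system {f g : A → Formula} (hf : Primrec f) (hg : Primrec g) :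
    Primrec fun a => system (f a) (g a) :=
  primrec_and (Primrec.const _) (primrec_and (Primrec.const _) (primrec_and
    (primrec_everywhere hf) (primrec_neg (primrec_everywhere (primrec_neg hg)))))

theorem primrec_bigAnd {f : A → List Formula} (hf : Primrec f) :
    Primrec fun a => bigAnd (f a) :=
  Primrec.list_foldr hf (Primrec.const top)
    (primrec_and (fst.comp snd) (snd.comp snd)).to₂

theorem primrec_bigOr {f : A → List Formula} (hf : Primrec f) :
    Primrec fun a => bigOr (f a) :=
  primrec_neg (primrec_bigAnd (Primrec.list_map hf (primrec_neg snd).to₂))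

end Computability

end LHS

namespace LHS

open Formula

/-! ### Tilings -/

/-- The formula stating that the left state carries the tile `T`. -/
def tileProp (T : Tile) : Formula := prop (Encodable.encode T)

/-- The tiles `T` and `T'` do not occur side by side, nor on top of each other, unless their
colors match. -/
def tileMatch (T T' : Tile) : Formula :=
  .and (if Tile.right T = Tile.left T' then top
      else imp (tileProp T) (.neg (diaL 0 (tileProp T'))))
    (if Tile.up T = Tile.down T' then top
      else imp (tileProp T) (.neg (diaL 1 (tileProp T'))))

/-- The relations `0` and `1` are serial and commute. -/
def gridAxiom : Formula :=
  .and (.and (diaL 0 top) (diaL 1 top)) (.and (.and (link 0) (link 1))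
    (boxL 0 (boxL 1 (boxR 1 (boxR 0 .eqc)))))

/-- The axioms of a commutative grid tiled by tiles from the list `l`. -/
def tilingAxiom (l : List Tile) : Formula :=
  .and gridAxiom (.and (bigOr (l.map tileProp))
    (bigAnd (l.map fun T => bigAnd (l.map fun T' => tileMatch T T'))))

theorem holds_gridAxiom {M : Model.{u}} {D : Type*} (I : Interp M D) {x : D} :
    Holds M (I.ι x) (I.ι x) gridAxiom ↔
      ((∃ y, I.relL 0 x y) ∧ ∃ y, I.relL 1 x y) ∧
      (((∀ y, I.relL 0 x y → I.relR 0 x y) ∧ ∀ y, I.relR 0 x y → I.relL 0 x y) ∧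
        ((∀ y, I.relL 1 x y → I.relR 1 x y) ∧ ∀ y, I.relR 1 x y → I.relL 1 x y)) ∧
      ∀ y, I.relL 0 x y → ∀ z, I.relL 1 y z → ∀ y', I.relR 1 x y' → ∀ z', I.relR 0 y' z' →
        z = z' := by
  simp only [gridAxiom, holds_and, I.holds_diaL, I.holds_link, I.holds_boxL, I.holds_boxR,
    I.holds_eqc, holds_top, and_true]

theorem holds_tileMatch {M : Model.{u}} {D : Type*} (I : Interp M D) {x : D} {T T' : Tile} :
    Holds M (I.ι x) (I.ι x) (tileMatch T T') ↔
      (Tile.right T ≠ Tile.left T' → Holds M (I.ι x) (I.ι x) (tileProp T) →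
        ∀ y, I.relL 0 x y → ¬ Holds M (I.ι y) (I.ι x) (tileProp T')) ∧
      (Tile.up T ≠ Tile.down T' → Holds M (I.ι x) (I.ι x) (tileProp T) →
        ∀ y, I.relL 1 x y → ¬ Holds M (I.ι y) (I.ι x) (tileProp T')) := by
  rw [tileMatch, holds_and]
  congr! 1
  all_goals
    split_ifs with h <;> simp [h, holds_top, holds_imp, holds_neg, I.holds_diaL]

theorem tilesQuadrant_of_satisfiable {l : List Tile}
    (h : Satisfiable.{u} (system (tilingAxiom l) top)) : TilesQuadrant l := by
  obtain ⟨M, D, I, hα, x₀, -⟩ := exists_interp_of_satisfiable h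
  simp only [tilingAxiom, holds_and, holds_gridAxiom, holds_bigOr, holds_bigAnd,
    List.mem_map, forall_exists_index, and_imp, forall_apply_eq_imp_iff₂,
    exists_exists_and_eq_and, holds_tileMatch] at hα
  choose H hH using fun x => (hα x).1.1.1
  choose V hV using fun x => (hα x).1.1.2
  choose T hTl hT using fun x => (hα x).2.1
  -- The left state goes along `H` then `V`, the right one along `V` then `H`. The links turn the
  -- chosen left successors into right ones.
  have comm : Function.Commute V H := fun x =>
    (hα x).1.2.2 _ (hH x) _ (hV _) _ ((hα x).1.2.1.2.1 _ (hV x)) _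
      ((hα _).1.2.1.1.1 _ (hH _))
  have hm := fun x => (hα x).2.2
  refine ⟨fun p => T (H^[p.1] (V^[p.2] x₀)), fun _ => hTl _, fun n m => ⟨?_, ?_⟩⟩
  · by_contra hne
    -- Tile propositions ignore the right state, so the diagonal fact `hT` also serves at the
    -- off-diagonal pair reached here.
    refine (hm _ _ (hTl _) _ (hTl _)).1 hne (hT _) _ (hH _) ?_
    simp only [Function.iterate_succ_apply']
    exact hT _
  · by_contra hne
    refine (hm _ _ (hTl _) _ (hTl _)).2 hne (hT _) _ (hV _) ?_
    simp only [Function.iterate_succ_apply']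
    -- The new vertical step is applied outside `H^[n]` and has to be moved inside.
    rw [(comm.iterate_right n).eq]
    exact hT _

theorem satisfiable_of_tilesQuadrant {l : List Tile} (h : TilesQuadrant l) :
    Satisfiable.{u} (system (tilingAxiom l) top) := by
  obtain ⟨g, hg, hm⟩ := h
  let rel : ℕ → ℕ × ℕ → ℕ × ℕ → Prop := fun k x y =>
    (k = 0 ∧ y = (x.1 + 1, x.2)) ∨ (k = 1 ∧ y = (x.1, x.2 + 1))
  let P : ℕ → ℕ × ℕ → Prop := fun k x => k = Encodable.encode (g x)
  have hP : ∀ T x t, Holds (codingModel.{u} rel P) ((codingInterp rel P).ι x) t (tileProp T) ↔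
      g x = T := by
    intro T x t
    rw [tileProp, holds_prop_coding]
    exact Encodable.encode_inj.trans eq_comm
  refine satisfiable_system rel P (fun x => ?_) ⟨(0, 0), holds_top.2 trivial⟩
  simp only [tilingAxiom, holds_and, holds_gridAxiom, holds_bigOr, holds_bigAnd,
    List.mem_map, forall_exists_index, and_imp, forall_apply_eq_imp_iff₂, exists_exists_and_eq_and,
    holds_tileMatch, hP, codingInterp_relL, codingInterp_relR]
  refine ⟨by simp [rel], ⟨_, hg x, rfl⟩, ?_⟩
  rintro T - T' -
  constructor
  · rintro hne rfl y (⟨-, rfl⟩ | ⟨h, -⟩) rfl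
    · exact hne (hm x.1 x.2).1
    · omega
  · rintro hne rfl y (⟨h, -⟩ | ⟨-, rfl⟩) rfl
    · omega
    · exact hne (hm x.1 x.2).2

theorem primrec_tilingAxiom : Primrec tilingAxiom := by
  open Primrec in
  have hp : ∀ {A : Type} [Primcodable A] {f : A → Tile}, Primrec f →
      Primrec fun a => tileProp (f a) := fun hf =>
    primrec_pl (primrec_affine 2 1 (Primrec.encode.comp hf))
  have hmatch : Primrec fun p : Tile × Tile => tileMatch p.1 p.2 := by
    refine primrec_and (Primrec.ite (Primrec.eq.comp ?_ ?_) (Primrec.const _) (primrec_imp (hp fst)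
      (primrec_neg (primrec_diaL 0 (hp snd))))) (Primrec.ite (Primrec.eq.comp ?_ ?_)
      (Primrec.const _) (primrec_imp (hp fst) (primrec_neg (primrec_diaL 1 (hp snd)))))
    · exact snd.comp (snd.comp (snd.comp fst))
    · exact fst.comp (snd.comp (snd.comp snd))
    · exact fst.comp fst
    · exact fst.comp (snd.comp snd)
  have hrow : Primrec₂ fun (l : List Tile) (T : Tile) =>
      bigAnd (l.map fun T' => tileMatch T T') :=
    primrec_bigAnd (Primrec.list_map fst
      (hmatch.comp (Primrec.pair (snd.comp fst) snd)).to₂)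
  exact primrec_and (Primrec.const _) (primrec_and
    (primrec_bigOr (Primrec.list_map Primrec.id (hp snd).to₂))
    (primrec_bigAnd (Primrec.list_map Primrec.id hrow)))

theorem tilesQuadrant_manyOneReducible :
    ManyOneReducible TilesQuadrant Satisfiable.{u} :=
  ⟨fun l => system (tilingAxiom l) top,
    (primrec_system primrec_tilingAxiom (Primrec.const _)).to_comp,
    fun _ => ⟨satisfiable_of_tilesQuadrant, tilesQuadrant_of_satisfiable⟩⟩

end LHS

namespace LHS

open Formula
open Turing.ToPartrec (Code)

/-! ### Evaluation of partial recursive functions -/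

/-- An injective numbering of the codes. -/
def codeLabel : Code → ℕ
  | .zero' => 0
  | .succ => 1
  | .tail => 2
  | .cons f g => 4 * Nat.pair (codeLabel f) (codeLabel g) + 3
  | .comp f g => 4 * Nat.pair (codeLabel f) (codeLabel g) + 4
  | .case f g => 4 * Nat.pair (codeLabel f) (codeLabel g) + 5
  | .fix f => 4 * codeLabel f + 6

theorem codeLabel_injective : Function.Injective codeLabel := by
  intro c
  induction c with
  | zero' | succ | tail => intro d h; cases d <;> simp only [codeLabel] at h <;> first | rfl | omega
  | fix f ih =>
    intro d h
    cases d <;> simp only [codeLabel, Nat.add_right_cancel_iff] at h <;> try omega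
    rw [ih (Nat.eq_of_mul_eq_mul_left (by norm_num) h)]
  | cons f g ihf ihg | comp f g ihf ihg | case f g ihf ihg =>
    intro d h
    cases d <;> simp only [codeLabel, Nat.add_right_cancel_iff] at h <;> try omega
    have := Nat.pair_eq_pair.1 (Nat.eq_of_mul_eq_mul_left (by norm_num) h)
    rw [ihf this.1, ihg this.2]

/-- The relation between a list and the singleton of its head. -/
abbrev opHead : ℕ := 0

/-- The predecessor relation on singletons. -/
abbrev opDec : ℕ := 1

/-- The relation between a list and the list with its head decremented. -/
abbrev opDecHead : ℕ := 2

/-- The graph of the partial function computed by a code. -/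
def opCode (c : Code) : ℕ := codeLabel c + 3

/-- The head of the list is zero. -/
def isZero : Formula := prop 0

/-- The list is empty. -/
def isNil : Formula := prop 1

/-- At a diagonal pair: the `k`-th relation is functional, with the same left and right versions. -/
def functional (k : ℕ) : Formula := .and (link k) (boxL k (boxR k .eqc))

/-- The axioms of the basic operations on lists. -/
def listAxiom : Formula :=
  bigAnd [functional opHead, functional opDec, functional opDecHead, functional (opCode .tail),
    imp isNil (.and (diaL opHead isZero) (diaL (opCode .tail) isNil)),
    boxL (opCode .tail) (diaR opDecHead (diaR (opCode .tail) .eqc)),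
    boxL opHead (boxL opDec (diaR opDecHead (diaR opHead .eqc)))]

/-- The axioms of the partial function computed by a code and those computed by its subcodes. -/
def codeAxiom : Code → Formula
  | .zero' => .and (functional (opCode .zero')) (.and (diaL (opCode .zero') (diaL opHead isZero))
      (diaR (opCode .zero') (diaR (opCode .tail) .eqc)))
  | .succ => .and (functional (opCode .succ)) (.and
      (diaL (opCode .succ) (.and (diaL opHead (.neg isZero)) (diaL (opCode .tail) isNil)))
      (boxL opHead (diaR (opCode .succ) (diaR opHead (diaR opDec .eqc)))))
  | .tail => functional (opCode .tail)
  | .cons f g => .and (.and (codeAxiom f) (codeAxiom g)) (.and (functional (opCode (.cons f g)))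
      (.and
        (imp (diaL (opCode f) top)
          (boxL (opCode g) (diaR (opCode (.cons f g)) (diaR (opCode .tail) .eqc))))
        (imp (diaL (opCode g) top)
          (boxL (opCode f) (boxL opHead (diaR (opCode (.cons f g)) (diaR opHead .eqc)))))))
  | .comp f g => .and (.and (codeAxiom f) (codeAxiom g)) (.and (functional (opCode (.comp f g)))
      (boxL (opCode g) (boxL (opCode f) (diaR (opCode (.comp f g)) .eqc))))
  | .case f g => .and (.and (codeAxiom f) (codeAxiom g)) (.and (functional (opCode (.case f g)))
      (.and
        (imp (diaL opHead isZero)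
          (boxL (opCode .tail) (boxL (opCode f) (diaR (opCode (.case f g)) .eqc))))
        (imp (diaL opHead (.neg isZero))
          (boxL opDecHead (boxL (opCode g) (diaR (opCode (.case f g)) .eqc))))))
  | .fix f => .and (codeAxiom f) (.and (functional (opCode (.fix f)))
      (boxL (opCode f) (.and
        (imp (diaL opHead isZero) (boxL (opCode .tail) (diaR (opCode (.fix f)) .eqc)))
        (imp (diaL opHead (.neg isZero))
          (boxL (opCode .tail) (boxL (opCode (.fix f)) (diaR (opCode (.fix f)) .eqc)))))))

/-- The left state is the number `n`. -/
def isNum : ℕ → Formula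
  | 0 => isZero
  | n + 1 => .and (.neg isZero) (diaL opDec (isNum n))

/-- The left state is the singleton list `[n]`, at which the code `c` is undefined. -/
def undefinedAt (c : Code) (n : ℕ) : Formula :=
  .and (.and (diaL opHead (isNum n)) (diaL (opCode .tail) isNil)) (.neg (diaL (opCode c) top))

/-! ### Computations inside an arbitrary model of the axioms -/

namespace Interp

variable {M : Model.{u}} {D : Type*} (I : Interp M D)

theorem holds_functional {k : ℕ} {x : D} :
    Holds M (I.ι x) (I.ι x) (functional k) ↔
      ((∀ y, I.relL k x y → I.relR k x y) ∧ ∀ y, I.relR k x y → I.relL k x y) ∧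
        ∀ y, I.relL k x y → ∀ z, I.relR k x z → y = z := by
  simp only [functional, holds_and, I.holds_link, I.holds_boxL, I.holds_boxR, I.holds_eqc]

/-- The left proposition `k`, as a predicate on the coded structure. -/
def P (k : ℕ) (x : D) : Prop := I.ι x ∈ M.V (Sum.inl (2 * k + 1))

theorem holds_isZero {x : D} {t : M.W} : Holds M (I.ι x) t isZero ↔ I.P 0 x := by
  simp [isZero, prop, Holds, P]

theorem holds_isNil {x : D} {t : M.W} : Holds M (I.ι x) t isNil ↔ I.P 1 x := by
  simp [isNil, prop, Holds, P]

/-- The element `x` represents the number `n`. -/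
def RepNum : D → ℕ → Prop
  | x, 0 => I.P 0 x
  | x, n + 1 => ¬ I.P 0 x ∧ ∃ y, I.relL opDec x y ∧ RepNum y n

/-- The element `x` represents the list `v`. -/
def RepList : D → List ℕ → Prop
  | x, [] => I.P 1 x
  | x, n :: v => (∃ h, I.relL opHead x h ∧ I.RepNum h n) ∧
      ∃ y, I.relL (opCode .tail) x y ∧ RepList y v

theorem holds_isNum {x : D} {t : M.W} {n : ℕ} :
    Holds M (I.ι x) t (isNum n) ↔ I.RepNum x n := by
  induction n generalizing x with
  | zero => exact I.holds_isZero
  | succ n ih => simp only [isNum, holds_and, holds_neg, I.holds_diaL, I.holds_isZero, ih, RepNum]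

/-- The coded relation `k` is functional, with the same left and right versions. -/
def Functional (k : ℕ) : Prop := ∀ x, Holds M (I.ι x) (I.ι x) (functional k)

variable {I}

theorem Functional.toL {k : ℕ} (h : I.Functional k) {x y : D} (hy : I.relR k x y) :
    I.relL k x y :=
  (I.holds_functional.1 (h x)).1.2 y hy

theorem Functional.eq {k : ℕ} (h : I.Functional k) {x y z : D} (hy : I.relL k x y)
    (hz : I.relL k x z) : y = z :=
  (I.holds_functional.1 (h x)).2 y hy z ((I.holds_functional.1 (h x)).1.1 z hz)

/-- Representatives of successors are required to fail `I.P 0`, so the zero test is faithful. -/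
theorem RepNum.eq_zero_iff {x : D} {n : ℕ} (h : I.RepNum x n) : n = 0 ↔ I.P 0 x := by
  cases n with
  | zero => simpa [RepNum] using h
  | succ n => simpa using h.1

variable (I) in
/-- The meaning of `listAxiom`. -/
structure ListLaws : Prop where
  head : I.Functional opHead
  dec : I.Functional opDec
  decHead : I.Functional opDecHead
  tail : I.Functional (opCode .tail)
  nil : ∀ x, I.P 1 x → (∃ h, I.relL opHead x h ∧ I.P 0 h) ∧ ∃ y, I.relL (opCode .tail) x y ∧ I.P 1 y
  tail_decHead : ∀ x y, I.relL (opCode .tail) x y →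
    ∃ z, I.relR opDecHead x z ∧ I.relR (opCode .tail) z y
  head_decHead : ∀ x h, I.relL opHead x h → ∀ h', I.relL opDec h h' →
    ∃ z, I.relR opDecHead x z ∧ I.relR opHead z h'

theorem listLaws (h : ∀ x, Holds M (I.ι x) (I.ι x) listAxiom) : I.ListLaws := by
  simp only [listAxiom, holds_bigAnd, List.forall_mem_cons, holds_imp, holds_and, I.holds_diaL,
    I.holds_diaR, I.holds_boxL, I.holds_eqc, I.holds_isZero, I.holds_isNil,
    exists_eq_right'] at h
  exact ⟨fun x => (h x).1, fun x => (h x).2.1, fun x => (h x).2.2.1, fun x => (h x).2.2.2.1,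
    fun x => (h x).2.2.2.2.1, fun x => (h x).2.2.2.2.2.1, fun x => (h x).2.2.2.2.2.2.1⟩

/-- The law for the empty list mirrors the default `[].headI = 0`; its second half similarly mirrors
`[].tail = []`. -/
theorem RepList.head (L : I.ListLaws) {x : D} {v : List ℕ} (h : I.RepList x v) :
    ∃ a, I.relL opHead x a ∧ I.RepNum a v.headI := by
  cases v with
  | nil => exact (L.nil x h).1
  | cons n v => exact h.1

theorem RepList.tail (L : I.ListLaws) {x : D} {v : List ℕ} (h : I.RepList x v) :
    ∃ y, I.relL (opCode .tail) x y ∧ I.RepList y v.tail := by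
  cases v with
  | nil => exact (L.nil x h).2
  | cons n v => exact h.2

theorem RepList.head_isZero (L : I.ListLaws) {x : D} {v : List ℕ} (h : I.RepList x v)
    (hv : v.headI = 0) : ∃ a, I.relL opHead x a ∧ I.P 0 a := by
  obtain ⟨a, ha, hn⟩ := h.head L
  exact ⟨a, ha, hn.eq_zero_iff.1 hv⟩

theorem RepList.head_not_isZero (L : I.ListLaws) {x : D} {v : List ℕ} (h : I.RepList x v)
    (hv : v.headI ≠ 0) : ∃ a, I.relL opHead x a ∧ ¬ I.P 0 a := by
  obtain ⟨a, ha, hn⟩ := h.head L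
  exact ⟨a, ha, fun h => hv (hn.eq_zero_iff.2 h)⟩

/-- One law yields a result with the right tail, another a result with the right head; functionality
identifies the two. -/
theorem RepList.decHead (L : I.ListLaws) {x : D} {v : List ℕ} {n : ℕ} (h : I.RepList x v)
    (hv : v.headI = n + 1) : ∃ z, I.relL opDecHead x z ∧ I.RepList z (n :: v.tail) := by
  obtain ⟨a, ha, hn⟩ := h.head L
  obtain ⟨y, hy, hyv⟩ := h.tail L
  rw [hv] at hn
  obtain ⟨-, b, hb, hbn⟩ := hn
  obtain ⟨z, hz, hzy⟩ := L.tail_decHead x y hy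
  obtain ⟨z', hz', hzb⟩ := L.head_decHead x a ha b hb
  obtain rfl := L.decHead.eq (L.decHead.toL hz) (L.decHead.toL hz')
  exact ⟨z, L.decHead.toL hz, ⟨b, L.head.toL hzb, hbn⟩, y, L.tail.toL hzy, hyv⟩

/-- In a model of the axioms, the coded relations extend the functions computed by codes. -/
theorem exists_of_mem_eval (L : I.ListLaws) {c : Code}
    (hc : ∀ x, Holds M (I.ι x) (I.ι x) (codeAxiom c)) {x : D} {v w : List ℕ}
    (hx : I.RepList x v) (hw : w ∈ c.eval v) :
    ∃ y, I.relL (opCode c) x y ∧ I.RepList y w := by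
  induction c generalizing x v w with
  | zero' =>
    simp only [codeAxiom, holds_and, I.holds_diaL, I.holds_diaR, I.holds_eqc, I.holds_isZero] at hc
    obtain rfl : w = 0 :: v := by simpa using hw
    obtain ⟨-, ⟨y, hy, a, ha, haz⟩, y', hy', z, hz, rfl⟩ := hc x
    have F : I.Functional (opCode .zero') := fun x => (hc x).1
    obtain rfl := F.eq hy (F.toL hy')
    exact ⟨y, hy, ⟨a, ha, haz⟩, x, L.tail.toL hz, hx⟩
  | succ =>
    simp only [codeAxiom, holds_and, holds_neg, I.holds_diaL, I.holds_diaR, I.holds_boxL,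
      I.holds_eqc, I.holds_isZero, I.holds_isNil] at hc
    obtain rfl : w = [v.headI.succ] := by simpa using hw
    have F : I.Functional (opCode .succ) := fun x => (hc x).1
    obtain ⟨-, ⟨y, hy, ⟨a, ha, haz⟩, z, hz, hzn⟩, h⟩ := hc x
    obtain ⟨b, hb, hbn⟩ := hx.head L
    obtain ⟨y', hy', a', ha', b', hb', rfl⟩ := h b hb
    obtain rfl := F.eq hy (F.toL hy')
    obtain rfl := L.head.eq ha (L.head.toL ha')
    exact ⟨y, hy, ⟨a, ha, haz, b, L.dec.toL hb', hbn⟩, z, hz, hzn⟩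
  | tail =>
    obtain rfl : w = v.tail := by simpa using hw
    exact hx.tail L
  | cons f g ihf ihg =>
    simp only [codeAxiom, holds_and, holds_imp, I.holds_diaL, I.holds_diaR, I.holds_boxL,
      I.holds_eqc, holds_top, and_true] at hc
    obtain ⟨w₁, h₁, w₂, h₂, rfl⟩ : ∃ w₁ ∈ f.eval v, ∃ w₂ ∈ g.eval v, w = w₁.headI :: w₂ := by
      simpa using hw
    have F : I.Functional (opCode (.cons f g)) := fun x => (hc x).2.1
    obtain ⟨y₁, hy₁, r₁⟩ := ihf (fun x => (hc x).1.1) hx h₁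
    obtain ⟨y₂, hy₂, r₂⟩ := ihg (fun x => (hc x).1.2) hx h₂
    obtain ⟨a, ha, hn⟩ := r₁.head L
    obtain ⟨y, hy, t, ht, rfl⟩ := (hc x).2.2.1 ⟨_, hy₁⟩ _ hy₂
    obtain ⟨y', hy', b, hb, rfl⟩ := (hc x).2.2.2 ⟨_, hy₂⟩ _ hy₁ _ ha
    -- The axioms specify the tail and the head of the output separately, since each equation
    -- compares only one pair of walks; functionality merges the witnesses.
    obtain rfl := F.eq (F.toL hy) (F.toL hy')
    exact ⟨y, F.toL hy, ⟨_, L.head.toL hb, hn⟩, _, L.tail.toL ht, r₂⟩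
  | comp f g ihf ihg =>
    simp only [codeAxiom, holds_and, I.holds_diaR, I.holds_boxL, I.holds_eqc] at hc
    obtain ⟨u, hu, hw⟩ : ∃ u ∈ g.eval v, w ∈ f.eval u := by
      rw [Code.comp_eval] at hw
      exact Part.mem_bind_iff.1 hw
    have F : I.Functional (opCode (.comp f g)) := fun x => (hc x).2.1
    obtain ⟨y, hy, r⟩ := ihg (fun x => (hc x).1.2) hx hu
    obtain ⟨z, hz, r⟩ := ihf (fun x => (hc x).1.1) r hw
    obtain ⟨_, h, rfl⟩ := (hc x).2.2 y hy z hz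
    exact ⟨z, F.toL h, r⟩
  | case f g ihf ihg =>
    simp only [codeAxiom, holds_and, holds_imp, holds_neg, I.holds_diaL, I.holds_diaR,
      I.holds_boxL, I.holds_eqc, I.holds_isZero] at hc
    have F : I.Functional (opCode (.case f g)) := fun x => (hc x).2.1
    rw [Code.case_eval] at hw
    rcases hv : v.headI with _ | n
    · simp only [hv] at hw
      obtain ⟨y, hy, r⟩ := hx.tail L
      obtain ⟨z, hz, r⟩ := ihf (fun x => (hc x).1.1) r hw
      obtain ⟨_, h, rfl⟩ := (hc x).2.2.1 (hx.head_isZero L hv) y hy z hz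
      exact ⟨z, F.toL h, r⟩
    · simp only [hv] at hw
      obtain ⟨y, hy, r⟩ := hx.decHead L hv
      obtain ⟨z, hz, r⟩ := ihg (fun x => (hc x).1.2) r hw
      obtain ⟨_, h, rfl⟩ := (hc x).2.2.2 (hx.head_not_isZero L (by omega)) y hy z hz
      exact ⟨z, F.toL h, r⟩
  | fix f ih =>
    simp only [codeAxiom, holds_and, holds_imp, holds_neg, I.holds_diaL, I.holds_diaR,
      I.holds_boxL, I.holds_eqc, I.holds_isZero] at hc
    have F : I.Functional (opCode (.fix f)) := fun x => (hc x).2.1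
    rw [Code.fix_eval] at hw
    -- Induction on the terminating run of the loop. The representing element is generalized because
    -- it changes with each iteration.
    refine PFun.fixInduction (C := fun v => ∀ x, I.RepList x v →
      ∃ y, I.relL (opCode (.fix f)) x y ∧ I.RepList y w) hw (fun v hw IH x hx => ?_) x hx
    replace hw := PFun.mem_fix_iff.1 hw
    -- The body outputs `u`: head zero ends the loop with result `u.tail`, otherwise the loop
    -- restarts at `u.tail`. The membership in the second case is what `IH` consumes.
    have key : ∃ u ∈ f.eval v, (u.headI = 0 ∧ w = u.tail) ∨
        (u.headI ≠ 0 ∧ Sum.inr u.tail ∈ (f.eval v).map fun v =>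
          if v.headI = 0 then Sum.inl v.tail else Sum.inr v.tail) := by
      rcases hw with hw | ⟨v', hw, -⟩
      · obtain ⟨u, hu, e⟩ := (Part.mem_map_iff _).1 hw
        refine ⟨u, hu, Or.inl ?_⟩
        split_ifs at e with h0
        exact ⟨h0, (Sum.inl_injective e).symm⟩
      · obtain ⟨u, hu, e⟩ := (Part.mem_map_iff _).1 hw
        refine ⟨u, hu, Or.inr ?_⟩
        split_ifs at e with h0
        rw [← Sum.inr_injective e] at hw
        exact ⟨h0, hw⟩
    obtain ⟨u, hu, h⟩ := key
    obtain ⟨y, hy, r⟩ := ih (fun x => (hc x).1) hx hu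
    obtain ⟨z, hz, rz⟩ := r.tail L
    rcases h with ⟨h0, rfl⟩ | ⟨h0, h⟩
    · obtain ⟨_, h, rfl⟩ := ((hc x).2.2 y hy).1 (r.head_isZero L h0) z hz
      exact ⟨z, F.toL h, rz⟩
    · obtain ⟨q, hq, rq⟩ := IH _ h _ rz
      obtain ⟨_, h, rfl⟩ := ((hc x).2.2 y hy).2 (r.head_not_isZero L h0) z hz q hq
      exact ⟨q, F.toL h, rq⟩

end Interp

/-- A halting computation would force an output in the model at the very element declared to have
none. -/
theorem not_dom_of_satisfiable {c : Code} {n : ℕ}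
    (h : Satisfiable.{u} (system (.and listAxiom (codeAxiom c)) (undefinedAt c n))) :
    ¬ (c.eval [n]).Dom := by
  obtain ⟨M, D, I, hα, x, hβ⟩ := exists_interp_of_satisfiable h
  simp only [holds_and] at hα
  simp only [undefinedAt, holds_and, holds_neg, I.holds_diaL, I.holds_isNum, I.holds_isNil,
    holds_top, and_true] at hβ
  intro hd
  obtain ⟨y, hy, -⟩ := Interp.exists_of_mem_eval (I := I)
    (Interp.listLaws fun x => (hα x).1) (fun x => (hα x).2) (x := x) (v := [n])
    ⟨hβ.1.1, hβ.1.2⟩ (Part.get_mem hd)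
  exact hβ.2 ⟨y, hy⟩

/-! ### The intended model -/

/-- The coded relations of the intended model. -/
def evalRel (k : ℕ) (v w : List ℕ) : Prop :=
  (k = opHead ∧ w = [v.headI]) ∨ (k = opDec ∧ w = [v.headI - 1]) ∨
    (k = opDecHead ∧ w = (v.headI - 1) :: v.tail) ∨ ∃ c, k = opCode c ∧ w ∈ c.eval v

/-- The propositions of the intended model. -/
def evalProp (k : ℕ) (v : List ℕ) : Prop := (k = 0 ∧ v.headI = 0) ∨ (k = 1 ∧ v = [])

theorem evalRel_head {v w : List ℕ} : evalRel opHead v w ↔ w = [v.headI] := by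
  simp [evalRel, opCode, opHead, opDec, opDecHead]

theorem evalRel_dec {v w : List ℕ} : evalRel opDec v w ↔ w = [v.headI - 1] := by
  simp [evalRel, opCode, opHead, opDec, opDecHead]

theorem evalRel_decHead {v w : List ℕ} :
    evalRel opDecHead v w ↔ w = (v.headI - 1) :: v.tail := by
  simp [evalRel, opCode, opHead, opDec, opDecHead]

theorem evalRel_code {c : Code} {v w : List ℕ} : evalRel (opCode c) v w ↔ w ∈ c.eval v := by
  have h : ∀ d, opCode c = opCode d ↔ c = d := fun d => by
    simp [opCode, codeLabel_injective.eq_iff]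
  simp only [evalRel, h]
  simp [opCode, opHead, opDec, opDecHead]

theorem evalRel_unique {k : ℕ} {v w w' : List ℕ} (h : evalRel k v w) (h' : evalRel k v w') :
    w = w' := by
  rcases id h with ⟨rfl, -⟩ | ⟨rfl, -⟩ | ⟨rfl, -⟩ | ⟨c, rfl, -⟩
  · rw [evalRel_head] at h h'; rw [h, h']
  · rw [evalRel_dec] at h h'; rw [h, h']
  · rw [evalRel_decHead] at h h'; rw [h, h']
  · rw [evalRel_code] at h h'; exact Part.mem_unique h h'

/-- The interpretation of the list operations and codes on lists of natural numbers. -/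
abbrev evalInterp : Interp (codingModel.{u} evalRel evalProp) (List ℕ) :=
  codingInterp evalRel evalProp

theorem holds_isZero_eval {v : List ℕ} {t} :
    Holds (codingModel.{u} evalRel evalProp) (evalInterp.ι v) t isZero ↔ v.headI = 0 := by
  rw [isZero, holds_prop_coding]; simp [evalProp]

theorem holds_isNil_eval {v : List ℕ} {t} :
    Holds (codingModel.{u} evalRel evalProp) (evalInterp.ι v) t isNil ↔ v = [] := by
  rw [isNil, holds_prop_coding]; simp [evalProp]

theorem holds_functional_eval (k : ℕ) (v : List ℕ) :
    Holds (codingModel.{u} evalRel evalProp) (evalInterp.ι v) (evalInterp.ι v) (functional k) := by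
  rw [Interp.holds_functional]
  exact ⟨⟨fun _ => id, fun _ => id⟩, fun _ h _ h' => evalRel_unique h h'⟩

theorem holds_listAxiom_eval (v : List ℕ) :
    Holds (codingModel.{u} evalRel evalProp) (evalInterp.ι v) (evalInterp.ι v) listAxiom := by
  simp only [listAxiom, holds_bigAnd, List.forall_mem_cons, holds_imp, holds_and,
    evalInterp.holds_diaL, evalInterp.holds_diaR, evalInterp.holds_boxL, evalInterp.holds_eqc,
    holds_functional_eval, holds_isZero_eval, holds_isNil_eval, codingInterp_relL,
    codingInterp_relR, evalRel_head, evalRel_dec, evalRel_decHead, evalRel_code]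
  simp
  rintro rfl
  exact ⟨rfl, rfl⟩

/-- The axioms are evaluation equations. Boxes, and for `cons` also the guards, make them vacuous
when a needed subcomputation diverges. -/
theorem holds_codeAxiom_eval (c : Code) (v : List ℕ) :
    Holds (codingModel.{u} evalRel evalProp) (evalInterp.ι v) (evalInterp.ι v) (codeAxiom c) := by
  induction c generalizing v with
  | tail => exact holds_functional_eval _ _
  | zero' | succ | cons =>
    simp only [codeAxiom, holds_imp, holds_and, holds_neg, holds_top,
      evalInterp.holds_diaL, evalInterp.holds_diaR, evalInterp.holds_boxL, evalInterp.holds_eqc,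
      holds_functional_eval, holds_isZero_eval, holds_isNil_eval, codingInterp_relL,
      codingInterp_relR, evalRel_head, evalRel_dec, evalRel_code, *]
    simp
    try grind
  | comp f g ihf ihg =>
    simp only [codeAxiom, holds_and, evalInterp.holds_diaR, evalInterp.holds_boxL,
      evalInterp.holds_eqc, holds_functional_eval, codingInterp_relL, codingInterp_relR,
      evalRel_code, ihf, ihg]
    refine ⟨⟨trivial, trivial⟩, trivial, fun u hu w hw => ⟨w, ?_, rfl⟩⟩
    rw [Code.comp_eval]
    exact Part.mem_bind hu hw
  | case f g ihf ihg =>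
    simp only [codeAxiom, holds_imp, holds_and, holds_neg, evalInterp.holds_diaL,
      evalInterp.holds_diaR, evalInterp.holds_boxL, evalInterp.holds_eqc,
      holds_functional_eval, holds_isZero_eval, codingInterp_relL, codingInterp_relR,
      evalRel_head, evalRel_decHead, evalRel_code, ihf, ihg]
    rcases hv : v.headI with _ | n <;> simp [hv]
  | fix f ih =>
    simp only [codeAxiom, holds_imp, holds_and, holds_neg, evalInterp.holds_diaL,
      evalInterp.holds_diaR, evalInterp.holds_boxL, evalInterp.holds_eqc,
      holds_functional_eval, holds_isZero_eval, codingInterp_relL, codingInterp_relR,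
      evalRel_head, evalRel_code, ih]
    refine ⟨trivial, trivial, fun u hu => ⟨?_, ?_⟩⟩
    · rintro ⟨_, rfl, h0⟩ z hz
      refine ⟨z, ?_, rfl⟩
      obtain rfl : z = u.tail := by simpa using hz
      rw [Code.fix_eval]
      exact PFun.mem_fix_iff.2 <| Or.inl ((Part.mem_map_iff _).2 ⟨u, hu, if_pos h0⟩)
    · rintro ⟨_, rfl, h0⟩ z hz w hw
      refine ⟨w, ?_, rfl⟩
      obtain rfl : z = u.tail := by simpa using hz
      rw [Code.fix_eval] at hw ⊢
      exact PFun.mem_fix_iff.2 <|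
        Or.inr ⟨u.tail, (Part.mem_map_iff _).2 ⟨u, hu, if_neg h0⟩, hw⟩

theorem repNum_eval (n : ℕ) : (evalInterp.{u}).RepNum [n] n := by
  induction n with
  -- The right state is irrelevant to `isNum`; the empty list is an arbitrary choice.
  | zero => rw [← Interp.holds_isNum (t := evalInterp.ι []), isNum, holds_isZero_eval]; rfl
  | succ n ih =>
    refine ⟨?_, [n], evalRel_dec.2 rfl, ih⟩
    rw [← Interp.holds_isZero (t := evalInterp.ι []), holds_isZero_eval]
    simp

theorem satisfiable_of_not_dom {c : Code} {n : ℕ} (h : ¬ (c.eval [n]).Dom) :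
    Satisfiable.{u} (system (.and listAxiom (codeAxiom c)) (undefinedAt c n)) := by
  refine satisfiable_system evalRel evalProp
    (fun v => ⟨holds_listAxiom_eval v, holds_codeAxiom_eval c v⟩) ⟨[n], ?_⟩
  simp only [undefinedAt, holds_and, holds_neg, evalInterp.holds_diaL, Interp.holds_isNum,
    holds_isNil_eval, codingInterp_relL, evalRel_head, evalRel_code]
  refine ⟨⟨⟨_, rfl, repNum_eval n⟩, [], by simp⟩, ?_⟩
  rintro ⟨w, hw, -⟩
  exact h (Part.dom_iff_mem.2 ⟨w, hw⟩)

/-! ### Reduction from the halting problem -/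

theorem primrec_undefinedAt (c : Code) : Primrec (undefinedAt c) := by
  have h : Primrec isNum :=
    (Primrec.nat_rec₁ (f := fun _ φ => .and (.neg isZero) (diaL opDec φ)) isZero
      (primrec_and (Primrec.const _) (primrec_diaL _ Primrec.snd)).to₂).of_eq fun n => by
        induction n with
        | zero => rfl
        | succ n ih => rw [isNum, ← ih]
  exact primrec_and (primrec_and (primrec_diaL _ h) (Primrec.const _)) (Primrec.const _)

/-- Fixing one universal code makes the axioms a constant formula, so that in the reduction only the
numeral for the input varies. -/
theorem exists_universal_code :
    ∃ c : Code, ∀ d : Nat.Partrec.Code, (c.eval [Encodable.encode d]).Dom ↔ (d.eval 0).Dom := by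
  have h : Partrec fun n : ℕ => (Denumerable.ofNat Nat.Partrec.Code n).eval 0 :=
    Nat.Partrec.Code.eval_part.comp (Computable.ofNat _) (Computable.const 0)
  obtain ⟨c, hc⟩ := Code.exists_code (Nat.Partrec'.part_iff₁.2 h)
  refine ⟨c, fun d => ?_⟩
  have := hc (Encodable.encode d ::ᵥ List.Vector.nil)
  simp only [List.Vector.head_cons, Denumerable.ofNat_encode] at this
  rw [show [Encodable.encode d] = (Encodable.encode d ::ᵥ List.Vector.nil).1 from rfl, this]
  rfl

theorem not_computablePred_satisfiable : ¬ ComputablePred Satisfiable.{u} := by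
  intro h
  obtain ⟨c, hc⟩ := exists_universal_code
  refine ComputablePred.halting_problem 0 ?_
  have hred : ManyOneReducible (fun d : Nat.Partrec.Code => ¬ (d.eval 0).Dom) Satisfiable.{u} :=
    ⟨fun d => system (.and listAxiom (codeAxiom c)) (undefinedAt c (Encodable.encode d)),
      (primrec_system (Primrec.const _)
        ((primrec_undefinedAt c).comp Primrec.encode)).to_comp,
      fun d => (not_congr (hc d)).symm.trans ⟨satisfiable_of_not_dom, not_dom_of_satisfiable⟩⟩
  exact (ComputablePred.computable_of_manyOneReducible hred h).not.of_eq fun _ => not_not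

end LHS

theorem mainTheorem1 :
    ¬ ComputablePred LHS.Satisfiable.{u} ∧
      ManyOneReducible LHS.TilesQuadrant LHS.Satisfiable.{u} :=
  ⟨LHS.not_computablePred_satisfiable, LHS.tilesQuadrant_manyOneReducible⟩
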